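/- For a finite set $A$ of integers and an integer $\alpha$ with $0 \le \alpha \le |A|$, let \[ \Sigma_{\alpha}(A) := \Big\{ \sum_{a \in A'} a \;:\; A' \subseteq A,\ |A'| \ge \alpha \Big\}. \] Let $A$ be a set of $k$ integers such that $A \cap (-A) = \{0\}$, where $-A = \{-a : a \in A\}$. Then for every integer $\alpha \in [0,k]$, \[ |\Sigma_{\alpha}(A)| \ \ge\ \frac{k(k-1)}{2} - \frac{\alpha(\alpha-1)}{2} + 1 . \] This lower bound is optimal: for all integers $k \ge 1$ and $0 \le \alpha \le k$, the set $A = [0,k-1] = \{0,1,\dots,k-1\}$ has $k$ elements, satisfies $A \cap (-A) = \{0\}$, and \[ |\Sigma_{\alpha}(A)| \ =\ \frac{k(k-1)}{2} - \frac{\alpha(\alpha-1)}{2} + 1 . \] -/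

import Mathlib

open scoped Pointwise

/-- `subsetSums α A` is the set `Σ_α(A)` of all sums of the elements of a subset of `A`
having at least `α` elements. -/
def subsetSums (α : ℕ) (A : Finset ℤ) : Finset ℤ :=
  {B ∈ A.powerset | α ≤ B.card}.image (fun B => ∑ a ∈ B, a)

/-! Taking complements turns sums of at least `α` elements into sums of at most `m = k - α`
elements, and for a lower bound 0 may be discarded. The remaining set is built up by increasing
absolute value: adjoining `x` to `n` smaller elements creates at least `min m (n + 1)` new sums
(`card_boundedSubsetSums_insert`), and adding these up gives the bound. For `[0, k-1]` every sum
lies in an interval of exactly that length. -/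

/-- The set of all sums of the elements of a subset of `A` having at most `m` elements. -/
def boundedSubsetSums (m : ℕ) (A : Finset ℤ) : Finset ℤ :=
  {B ∈ A.powerset | B.card ≤ m}.image (fun B => ∑ a ∈ B, a)

theorem mem_boundedSubsetSums {m : ℕ} {A : Finset ℤ} {s : ℤ} :
    s ∈ boundedSubsetSums m A ↔ ∃ B ⊆ A, B.card ≤ m ∧ ∑ a ∈ B, a = s := by
  simp [boundedSubsetSums, and_assoc]

theorem mem_subsetSums {α : ℕ} {A : Finset ℤ} {s : ℤ} :
    s ∈ subsetSums α A ↔ ∃ B ⊆ A, α ≤ B.card ∧ ∑ a ∈ B, a = s := by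
  simp [subsetSums, and_assoc]

theorem boundedSubsetSums_mono {m : ℕ} {A C : Finset ℤ} (h : A ⊆ C) :
    boundedSubsetSums m A ⊆ boundedSubsetSums m C := by
  intro s hs
  obtain ⟨B, hB, hc, rfl⟩ := mem_boundedSubsetSums.1 hs
  exact mem_boundedSubsetSums.2 ⟨B, hB.trans h, hc, rfl⟩

theorem neg_mem_boundedSubsetSums_neg {m : ℕ} {A : Finset ℤ} {s : ℤ}
    (hs : s ∈ boundedSubsetSums m A) : -s ∈ boundedSubsetSums m (-A) := by
  obtain ⟨B, hB, hc, rfl⟩ := mem_boundedSubsetSums.1 hs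
  refine mem_boundedSubsetSums.2 ⟨-B, Finset.neg_subset_neg hB, by simpa using hc, ?_⟩
  rw [Finset.sum_neg_index, Finset.sum_neg_distrib]

theorem card_boundedSubsetSums_le_neg (m : ℕ) (A : Finset ℤ) :
    (boundedSubsetSums m A).card ≤ (boundedSubsetSums m (-A)).card :=
  Finset.card_le_card_of_injOn (fun s => -s) (fun _ hs => neg_mem_boundedSubsetSums_neg hs)
    neg_injective.injOn

theorem card_boundedSubsetSums_neg (m : ℕ) (A : Finset ℤ) :
    (boundedSubsetSums m (-A)).card = (boundedSubsetSums m A).card :=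
  le_antisymm (by simpa using card_boundedSubsetSums_le_neg m (-A))
    (card_boundedSubsetSums_le_neg m A)

/-! ### Growth when an element is adjoined -/

/-- Sums that exceed every bounded subset sum of `C` contribute additionally to those of a
larger set. -/
theorem card_add_card_le_card_boundedSubsetSums {m : ℕ} {A C N : Finset ℤ} {M : ℤ} (hCA : C ⊆ A)
    (hM : ∀ s ∈ boundedSubsetSums m C, s ≤ M) (hN : N ⊆ boundedSubsetSums m A)
    (hNM : ∀ s ∈ N, M < s) :
    (boundedSubsetSums m C).card + N.card ≤ (boundedSubsetSums m A).card := by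
  rw [← Finset.card_union_of_disjoint]
  · exact Finset.card_le_card (Finset.union_subset (boundedSubsetSums_mono hCA) hN)
  · exact Finset.disjoint_left.2 fun s h h' => absurd (hM s h) (not_le.2 (hNM s h'))

/-- Let `T` attain the largest bounded sum of `C`. Adjoining `x` to `T` and then lowering the sum by
some `|z| < x` still beats that maximum; the cases differ in how much room `T` leaves below `m`. -/
theorem card_boundedSubsetSums_insert_of_pos {m : ℕ} {C : Finset ℤ} {x : ℤ}
    (hx : 0 < x) (hC : ∀ z ∈ C, |z| < x) (hneg : ∀ z ∈ C, -z ∉ C) :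
    (boundedSubsetSums m C).card + min m (C.card + 1) ≤
      (boundedSubsetSums m (insert x C)).card := by
  have hxC : x ∉ C := fun h => absurd (hC x h) (not_lt.2 (le_abs_self x))
  have hzero : ∀ z ∈ C, z ≠ 0 := by
    rintro z hz rfl
    exact hneg 0 hz (by simpa using hz)
  obtain ⟨T, hT, hmax⟩ := Finset.exists_max_image {B ∈ C.powerset | B.card ≤ m}
    (fun B => ∑ a ∈ B, a) ⟨∅, by simp⟩
  simp only [Finset.mem_filter, Finset.mem_powerset, and_imp] at hT hmax
  obtain ⟨hTC, hTm⟩ := hT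
  have hxT : x ∉ T := fun h => hxC (hTC h)
  have hM : ∀ s ∈ boundedSubsetSums m C, s ≤ ∑ a ∈ T, a := by
    intro s hs
    obtain ⟨B, hB, hc, rfl⟩ := mem_boundedSubsetSums.1 hs
    exact hmax B hB hc
  have hsub : C ⊆ insert x C := Finset.subset_insert x C
  have hremove : ∀ y ∈ T, x + ∑ a ∈ T, a - y ∈ boundedSubsetSums m (insert x C) := by
    intro y hy
    refine mem_boundedSubsetSums.2 ⟨insert x (T.erase y),
      Finset.insert_subset_insert x ((Finset.erase_subset y T).trans hTC), ?_, ?_⟩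
    · rw [Finset.card_insert_of_notMem (fun h => hxT (Finset.mem_of_mem_erase h)),
        Finset.card_erase_add_one hy]
      exact hTm
    · rw [Finset.sum_insert (fun h => hxT (Finset.mem_of_mem_erase h))]
      linarith [Finset.add_sum_erase T (fun a => a) hy]
  have hkeep : T.card < m → x + ∑ a ∈ T, a ∈ boundedSubsetSums m (insert x C) := by
    intro h
    refine mem_boundedSubsetSums.2 ⟨insert x T, Finset.insert_subset_insert x hTC, ?_, ?_⟩
    · rw [Finset.card_insert_of_notMem hxT]; exact h
    · rw [Finset.sum_insert hxT]
  have hpos : ∀ y ∈ T, 0 < y := by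
    intro y hy
    have h := hmax (T.erase y) ((Finset.erase_subset y T).trans hTC)
      ((Finset.card_le_card (Finset.erase_subset y T)).trans hTm)
    have h' := Finset.add_sum_erase T (fun a => a) hy
    have := hzero y (hTC hy)
    omega
  have hlt : ∀ z ∈ C, z < x := fun z hz => (abs_lt.1 (hC z hz)).2
  have hinj : Function.Injective (fun y : ℤ => x + ∑ a ∈ T, a - y) := sub_right_injective
  rcases hTm.eq_or_lt with hTm' | hTm'
  · have := card_add_card_le_card_boundedSubsetSums
      (N := T.image fun y => x + ∑ a ∈ T, a - y) hsub hM
      (by simpa [Finset.image_subset_iff] using hremove)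
      (by
        simp only [Finset.forall_mem_image]
        intro y hy
        linarith [hlt y (hTC hy)])
    rw [Finset.card_image_of_injective _ hinj] at this
    omega
  rcases (Nat.succ_le_of_lt hTm').eq_or_lt with hTm'' | hTm''
  · have h0 : (0 : ℤ) ∉ T := fun h => hzero 0 (hTC h) rfl
    have := card_add_card_le_card_boundedSubsetSums
      (N := (insert 0 T).image fun y => x + ∑ a ∈ T, a - y) hsub hM
      (by
        simp only [Finset.image_subset_iff, Finset.forall_mem_insert, sub_zero]
        exact ⟨hkeep hTm', hremove⟩)
      (by
        simp only [Finset.forall_mem_image, Finset.forall_mem_insert]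
        exact ⟨by linarith, fun y hy => by linarith [hlt y (hTC hy)]⟩)
    rw [Finset.card_image_of_injective _ hinj, Finset.card_insert_of_notMem h0] at this
    omega
  -- With room for two more elements, `T` is the set of positive elements of `C`. Each `|z|` can
  -- then be subtracted, by removing `z > 0` or adding `z < 0`; these values are distinct since `C`
  -- has no opposite pair.
  · have hnonpos : ∀ z ∈ C, z ∉ T → z < 0 := by
      intro z hz hzT
      have h := hmax (insert z T) (Finset.insert_subset hz hTC)
        (by rw [Finset.card_insert_of_notMem hzT]; omega)
      rw [Finset.sum_insert hzT] at h
      have := hzero z hz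
      omega
    have hadd : ∀ z ∈ C, z ∉ T → x + ∑ a ∈ T, a + z ∈ boundedSubsetSums m (insert x C) := by
      intro z hz hzT
      have hxz : x ∉ insert z T := by
        rw [Finset.mem_insert, not_or]
        exact ⟨fun h => hxC (h ▸ hz), hxT⟩
      refine mem_boundedSubsetSums.2 ⟨insert x (insert z T),
        Finset.insert_subset_insert x (Finset.insert_subset hz hTC), ?_, ?_⟩
      · rw [Finset.card_insert_of_notMem hxz, Finset.card_insert_of_notMem hzT]; omega
      · rw [Finset.sum_insert hxz, Finset.sum_insert hzT]; ring
    have habs : Set.InjOn (fun z : ℤ => |z|) C := by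
      intro z hz w hw h
      rcases abs_eq_abs.1 h with h | h
      · exact h
      · exact absurd (h ▸ hz) (hneg w hw)
    have h0 : (0 : ℤ) ∉ C.image (fun z : ℤ => |z|) := by
      simpa using fun h => hzero 0 h rfl
    have := card_add_card_le_card_boundedSubsetSums
      (N := (insert 0 (C.image fun z : ℤ => |z|)).image fun y => x + ∑ a ∈ T, a - y) hsub hM
      (by
        simp only [Finset.image_subset_iff, Finset.forall_mem_insert, sub_zero,
          Finset.forall_mem_image]
        refine ⟨hkeep hTm', fun z hz => ?_⟩
        by_cases hzT : z ∈ T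
        · rw [abs_of_pos (hpos z hzT)]
          exact hremove z hzT
        · rw [abs_of_neg (hnonpos z hz hzT), sub_neg_eq_add]
          exact hadd z hz hzT)
      (by
        simp only [Finset.forall_mem_insert, Finset.forall_mem_image]
        exact ⟨by linarith, fun z hz => by linarith [hC z hz]⟩)
    rw [Finset.card_image_of_injective _ hinj, Finset.card_insert_of_notMem h0,
      Finset.card_image_of_injOn habs] at this
    omega

theorem card_boundedSubsetSums_insert {m : ℕ} {C : Finset ℤ} {x : ℤ} (hx : x ≠ 0)
    (hC : ∀ z ∈ C, |z| < |x|) (hneg : ∀ z ∈ C, -z ∉ C) :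
    (boundedSubsetSums m C).card + min m (C.card + 1) ≤
      (boundedSubsetSums m (insert x C)).card := by
  rcases hx.lt_or_gt with h | h
  · have := card_boundedSubsetSums_insert_of_pos (m := m) (C := -C) (x := -x) (neg_pos.2 h)
      (fun z hz => by simpa [abs_of_neg h] using hC (-z) (Finset.mem_neg'.1 hz))
      (fun z hz hz' => hneg (-z) (Finset.mem_neg'.1 hz) (Finset.mem_neg'.1 hz'))
    rwa [← Finset.neg_insert, card_boundedSubsetSums_neg, card_boundedSubsetSums_neg,
      Finset.card_neg] at this
  · exact card_boundedSubsetSums_insert_of_pos h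
      (fun z hz => by simpa [abs_of_pos h] using hC z hz) hneg

/-- The truncated `A.card - m` makes the correction vanish when the size limit is not binding. -/
theorem le_card_boundedSubsetSums (m : ℕ) (A : Finset ℤ) (hA : ∀ a ∈ A, -a ∉ A) :
    A.card * (A.card + 1) + 2 ≤
      2 * (boundedSubsetSums m A).card + (A.card - m) * (A.card - m + 1) := by
  induction A using Finset.induction_on_max_value (fun z : ℤ => |z|) with
  | empty =>
    have : (0 : ℤ) ∈ boundedSubsetSums m ∅ := mem_boundedSubsetSums.2 ⟨∅, by simp⟩
    have := Finset.card_pos.2 ⟨0, this⟩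
    rw [Finset.card_empty, zero_tsub]
    omega
  | insert x C hxC hmax ih =>
    have hneg : ∀ z ∈ C, -z ∉ C := fun z hz hz' =>
      hA z (Finset.mem_insert_of_mem hz) (Finset.mem_insert_of_mem hz')
    have hx : x ≠ 0 := by
      rintro rfl
      exact hA 0 (Finset.mem_insert_self _ _) (by simp)
    have hlt : ∀ z ∈ C, |z| < |x| := by
      intro z hz
      refine lt_of_le_of_ne (hmax z hz) fun h => ?_
      rcases abs_eq_abs.1 h with rfl | rfl
      · exact hxC hz
      · exact hA x (Finset.mem_insert_self _ _) (Finset.mem_insert_of_mem hz)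
    have hstep := card_boundedSubsetSums_insert (m := m) hx hlt hneg
    have ih := ih hneg
    rw [Finset.card_insert_of_notMem hxC]
    generalize C.card = n at *
    rcases le_or_gt m n with h | h
    · obtain ⟨d, rfl⟩ := Nat.exists_eq_add_of_le h
      rw [min_eq_left (by omega)] at hstep
      rw [show m + d - m = d by omega] at ih
      rw [show m + d + 1 - m = d + 1 by omega]
      nlinarith
    · rw [min_eq_right (by omega)] at hstep
      rw [show n - m = 0 by omega] at ih
      rw [show n + 1 - m = 0 by omega]
      nlinarith

/-! ### Passing to complements -/

theorem card_boundedSubsetSums_le_card_subsetSums {α : ℕ} {A C : Finset ℤ} (hα : α ≤ A.card)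
    (hC : C ⊆ A) : (boundedSubsetSums (A.card - α) C).card ≤ (subsetSums α A).card := by
  refine Finset.card_le_card_of_injOn (fun s => ∑ a ∈ A, a - s) (fun s hs => ?_)
    sub_right_injective.injOn
  obtain ⟨B, hB, hc, rfl⟩ := mem_boundedSubsetSums.1 hs
  refine mem_subsetSums.2 ⟨A \ B, Finset.sdiff_subset, ?_, ?_⟩
  · rw [Finset.card_sdiff_of_subset (hB.trans hC)]
    omega
  · rw [eq_sub_iff_add_eq]
    exact Finset.sum_sdiff (hB.trans hC)

theorem le_card_subsetSums {α : ℕ} {A : Finset ℤ} (hA : A ∩ (-A) = {0}) (hα : α ≤ A.card) :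
    (A.card : ℚ) * ((A.card : ℚ) - 1) / 2 - (α : ℚ) * ((α : ℚ) - 1) / 2 + 1
      ≤ ((subsetSums α A).card : ℚ) := by
  have h0 : (0 : ℤ) ∈ A := Finset.mem_of_mem_inter_left (hA ▸ Finset.mem_singleton_self 0)
  have hneg : ∀ a ∈ A.erase 0, -a ∉ A.erase 0 := by
    intro a ha ha'
    have : a ∈ A ∩ (-A) := Finset.mem_inter.2
      ⟨Finset.mem_of_mem_erase ha, Finset.mem_neg'.2 (Finset.mem_of_mem_erase ha')⟩
    rw [hA, Finset.mem_singleton] at this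
    exact Finset.ne_of_mem_erase ha this
  have h := le_card_boundedSubsetSums (A.card - α) (A.erase 0) hneg
  have hle := card_boundedSubsetSums_le_card_subsetSums hα (Finset.erase_subset 0 A)
  rw [← Finset.card_erase_add_one h0] at *
  generalize (A.erase 0).card = n at *
  have hq : (n : ℚ) * (n + 1) + 2 ≤ 2 * (subsetSums α A).card + (α : ℚ) * (α - 1) := by
    -- The correction involves `n - (n + 1 - α)`, which is `α - 1` truncated at 0.
    rcases α with _ | β
    · rw [show n - (n + 1 - 0) = 0 by omega] at h
      have : n * (n + 1) + 2 ≤ 2 * (subsetSums 0 A).card := by omega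
      have : (n : ℚ) * (n + 1) + 2 ≤ 2 * (subsetSums 0 A).card := by exact_mod_cast this
      simpa using this
    · rw [show n - (n + 1 - (β + 1)) = β by omega] at h
      have : n * (n + 1) + 2 ≤ 2 * (subsetSums (β + 1) A).card + β * (β + 1) := by omega
      have : (n : ℚ) * (n + 1) + 2 ≤ 2 * (subsetSums (β + 1) A).card + β * (β + 1) := by
        exact_mod_cast this
      push_cast
      linarith
  push_cast
  linarith

/-! ### Optimality for the interval -/

theorem card_mul_card_sub_one_le_two_mul_sum (B : Finset ℤ) (hB : ∀ b ∈ B, 0 ≤ b) :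
    (B.card : ℤ) * (B.card - 1) ≤ 2 * ∑ b ∈ B, b := by
  induction B using Finset.induction_on_max with
  | empty => simp
  | insert x C hx ih =>
    have hxC : x ∉ C := fun h => lt_irrefl x (hx x h)
    have ih := ih fun b hb => hB b (Finset.mem_insert_of_mem hb)
    have hx0 := hB x (Finset.mem_insert_self _ _)
    have hcard : C.card ≤ (Finset.Ico 0 x).card := Finset.card_le_card fun b hb =>
      Finset.mem_Ico.2 ⟨hB b (Finset.mem_insert_of_mem hb), hx b hb⟩
    rw [Int.card_Ico] at hcard
    have : (C.card : ℤ) ≤ x := by omega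
    rw [Finset.card_insert_of_notMem hxC, Finset.sum_insert hxC]
    push_cast
    linarith

theorem two_mul_sum_Icc_zero (k : ℕ) :
    2 * ∑ a ∈ Finset.Icc (0 : ℤ) ((k : ℤ) - 1), a = (k : ℤ) * (k - 1) := by
  induction k with
  | zero => simp
  | succ k ih =>
    have : Finset.Icc (0 : ℤ) (((k + 1 : ℕ) : ℤ) - 1) =
        insert (k : ℤ) (Finset.Icc (0 : ℤ) ((k : ℤ) - 1)) := by
      ext a
      simp only [Finset.mem_Icc, Finset.mem_insert]
      omega
    rw [this, Finset.sum_insert (by simp), mul_add, ih]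
    push_cast
    ring

theorem card_subsetSums_Icc_le {k α : ℕ} (hα : α ≤ k) :
    ((subsetSums α (Finset.Icc (0 : ℤ) ((k : ℤ) - 1))).card : ℚ)
      ≤ (k : ℚ) * ((k : ℚ) - 1) / 2 - (α : ℚ) * ((α : ℚ) - 1) / 2 + 1 := by
  have hαsum := two_mul_sum_Icc_zero α
  have hksum := two_mul_sum_Icc_zero k
  set I := Finset.Icc (0 : ℤ) ((k : ℤ) - 1) with hI
  set p := ∑ a ∈ Finset.Icc (0 : ℤ) ((α : ℤ) - 1), a
  set q := ∑ a ∈ I, a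
  have hI0 : ∀ a ∈ I, 0 ≤ a := fun a ha => (Finset.mem_Icc.1 ha).1
  have hmul : ∀ c : ℕ, α ≤ c → (α : ℤ) * (α - 1) ≤ (c : ℤ) * (c - 1) := by
    intro c hc
    rcases Nat.eq_zero_or_pos c with rfl | hc'
    · simp [Nat.le_zero.1 hc]
    · have h1 : (α : ℤ) ≤ c := by exact_mod_cast hc
      have h2 : (1 : ℤ) ≤ c := by exact_mod_cast hc'
      nlinarith
  -- The extremes are the sum of the `α` smallest elements and the full sum.
  have hsub : subsetSums α I ⊆ Finset.Icc p q := by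
    intro s hs
    obtain ⟨B, hB, hc, rfl⟩ := mem_subsetSums.1 hs
    refine Finset.mem_Icc.2 ⟨?_, ?_⟩
    · have := card_mul_card_sub_one_le_two_mul_sum B fun b hb => hI0 b (hB hb)
      have := hmul B.card hc
      linarith
    · exact Finset.sum_le_sum_of_subset_of_nonneg hB fun a ha _ => hI0 a ha
  have hpq : p ≤ q := by linarith [hmul k hα]
  have hcard := Finset.card_le_card hsub
  rw [Int.card_Icc] at hcard
  have hcard' : ((subsetSums α I).card : ℤ) ≤ q + 1 - p := by omega
  have hq : ((subsetSums α I).card : ℚ) ≤ q + 1 - p := by exact_mod_cast hcard'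
  have h1 : (2 : ℚ) * p = α * (α - 1) := by exact_mod_cast hαsum
  have h2 : (2 : ℚ) * q = k * (k - 1) := by exact_mod_cast hksum
  linarith

theorem Icc_zero_inter_neg {k : ℕ} (hk : 1 ≤ k) :
    Finset.Icc (0 : ℤ) ((k : ℤ) - 1) ∩ (-Finset.Icc (0 : ℤ) ((k : ℤ) - 1)) = {0} := by
  ext a
  simp only [Finset.mem_inter, Finset.mem_neg', Finset.mem_Icc, Finset.mem_singleton]
  omega

theorem corollary2p2 :
    (∀ (k α : ℕ) (A : Finset ℤ), A.card = k → A ∩ (-A) = {0} → α ≤ k →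
      (k : ℚ) * ((k : ℚ) - 1) / 2 - (α : ℚ) * ((α : ℚ) - 1) / 2 + 1
        ≤ ((subsetSums α A).card : ℚ)) ∧
    (∀ k α : ℕ, 1 ≤ k → α ≤ k →
      (Finset.Icc (0 : ℤ) ((k : ℤ) - 1)).card = k ∧
      Finset.Icc (0 : ℤ) ((k : ℤ) - 1) ∩ (-Finset.Icc (0 : ℤ) ((k : ℤ) - 1)) = {0} ∧
      ((subsetSums α (Finset.Icc (0 : ℤ) ((k : ℤ) - 1))).card : ℚ)
        = (k : ℚ) * ((k : ℚ) - 1) / 2 - (α : ℚ) * ((α : ℚ) - 1) / 2 + 1) := by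
  refine ⟨fun k α A hk hA hα => ?_, fun k α hk hα => ?_⟩
  · subst hk
    exact le_card_subsetSums hA hα
  · have hcard : (Finset.Icc (0 : ℤ) ((k : ℤ) - 1)).card = k := by simp
    have hinter := Icc_zero_inter_neg hk
    refine ⟨hcard, hinter, le_antisymm (card_subsetSums_Icc_le hα) ?_⟩
    have := le_card_subsetSums (α := α) hinter (by rwa [hcard])
    rwa [hcard] at this
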